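/- Let $\varphi$ be the standard normal density. Let $\mathcal F$ be the set of all densities $f=\varphi\star\Pi$, that is $f(x)=\int\varphi(x-u)\,d\Pi(u)$, where $\Pi$ is an arbitrary Borel probability measure on $\mathbb R$, and let $\mathcal F_0\subseteq\mathcal F$ be the set of those densities $\varphi\star\Pi$ for which $\Pi$ is absolutely continuous with respect to Lebesgue measure. For $n\ge 2$ put $$\ell_n=\log n\cdot\frac1{n\sqrt{\log n}}=\frac{\sqrt{\log n}}{n}.$$ An estimator $\hat f_n$ is a function of $n$ observations $X_1,\dots,X_n$ with values in the real functions on $\mathbb R$, such that $(X_1,\dots,X_n,x)\mapsto \hat f_n(X_1,\dots,X_n)(x)$ is jointly measurable, and $\mathbb E_{n,f}$ is the expectation when $X_1,\dots,X_n$ are independent with common density $f$. Risks may be $+\infty$. (i) There is a constant $c>0$ such that, for every $n\ge 2$ and every estimator $\hat f_n$, $$\sup_{f\in\mathcal F}\mathbb E_{n,f}\int_{-\infty}^{\infty}\bigl(\hat f_n(x)-f(x)\bigr)^2dx\ \ge\ c\,\ell_n, \qquad \sup_{f\in\mathcal F_0}\mathbb E_{n,f}\int_{-\infty}^{\infty}\bigl(\hat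 f_n(x)-f(x)\bigr)^2dx\ \ge\ c\,\ell_n .$$ (ii) There is a constant $C>0$ such that, for every $n\ge 2$, there is an estimator $\hat f_n$ with $$\sup_{f\in\mathcal F}\mathbb E_{n,f}\int_{-\infty}^{\infty}\bigl(\hat f_n(x)-f(x)\bigr)^2dx\ \le\ C\,\ell_n .$$ Hence $\ell_n$ is the minimax rate for the squared $L_2$ risk over $\mathcal F$, and over every class between $\mathcal F_0$ and $\mathcal F$. -/

import Mathlib

open MeasureTheory ProbabilityTheory
open scoped ENNReal

noncomputable section

/-- The location mixture `φ ⋆ Π` of the standard normal density with mixing measure `Π`: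
`x ↦ ∫ φ(x - u) dΠ(u)`. -/
def normalMixture (Pi : Measure ℝ) : ℝ → ℝ :=
  fun x => ∫ u, gaussianPDFReal 0 1 (x - u) ∂Pi

/-- The class of all normal location mixture densities, with an arbitrary (Borel) probability
measure on the line as mixing measure. -/
def mixtureClass : Set (ℝ → ℝ) :=
  {f | ∃ Pi : Measure ℝ, IsProbabilityMeasure Pi ∧ f = normalMixture Pi}

/-- The normal location mixture densities whose mixing measure is absolutely continuous with
respect to Lebesgue measure. -/
def mixtureClassAC : Set (ℝ → ℝ) :=
  {f | ∃ Pi : Measure ℝ, IsProbabilityMeasure Pi ∧ Pi ≪ volume ∧ f = normalMixture Pi}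

/-- The probability distribution on the line with Lebesgue density `f`. -/
def densityLaw (f : ℝ → ℝ) : Measure ℝ :=
  volume.withDensity (fun x => ENNReal.ofReal (f x))

/-- The joint law of `n` independent observations with density `f`. -/
def sampleLaw (n : ℕ) (f : ℝ → ℝ) : Measure (Fin n → ℝ) :=
  Measure.pi (fun _ => densityLaw f)

/-- An estimator of a density from `n` observations: the value `fhat X x` at the point `x` of the
function estimated from the sample `X` is jointly measurable in `(X, x)`. No integrability, sign or
membership in a class of densities is required. -/
def IsEstimator (n : ℕ) (fhat : (Fin n → ℝ) → ℝ → ℝ) : Prop :=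
  Measurable (Function.uncurry fhat)

/-- The squared `L₂` loss `∫ (g - f)²`, possibly infinite. -/
def sqLoss (g f : ℝ → ℝ) : ℝ≥0∞ :=
  ∫⁻ x, ENNReal.ofReal ((g x - f x) ^ 2)

/-- The expected squared `L₂` loss of the estimator `fhat` when the `n` independent observations
have density `f`, possibly infinite. -/
def risk (n : ℕ) (fhat : (Fin n → ℝ) → ℝ → ℝ) (f : ℝ → ℝ) : ℝ≥0∞ :=
  ∫⁻ X, sqLoss (fhat X) f ∂(sampleLaw n f)

/-- The rate `log n / (n √(log n))`, which is used for `n ≥ 2` only. -/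
def rate (n : ℕ) : ℝ :=
  Real.log n * (1 / (n * Real.sqrt (Real.log n)))

end

/-! ### Characteristic function and Fourier inversion for Gaussian laws -/

section GaussianTransform

variable (μ : ℝ) (v : NNReal) (t : ℝ)

/-! Convolution with the normal density damps the frequency `t` by `exp(-t²/2)`, so at sample size
`n` only frequencies up to order `√(log n)` can be distinguished from noise.

Upper bound: the kernel estimator with kernel `sincKernel T`, which keeps the frequencies in `[-T,
T]`, has integrated variance of order at most `T / n`. Its bias at a mixture averages translates of
the bias at the normal density, whose squared norm is of order at most `exp(-T²)`
(`lintegral_sincBias_sq_le`). The bound of `risk_kernelEstimator_le` is thus uniform in the mixing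
measure, and `T = 1 + √(log n)` gives the rate.

Lower bound: tilt the standard normal mixing law by a sine polynomial. By `normalMixture_sineTilt`
the mixture is the N(0,2) density times one plus a damped sine polynomial in `x / 2`. Coefficients
`± β exp((j+1)²/4)` undo the damping, and with `β` of order `1/√n` about `√(log n)` frequencies fit
before the tilt could turn negative. Adjacent vertices of this cube have samples of affinity at
least `1/2`, so each sign costs squared error of order `β²` (`two_point_bound`). Bessel's inequality
and averaging over the cube (`cube_average`) add these costs to `√(log n) / n`. The tilted laws are
absolutely continuous, so the bound holds on the smaller class and hence on the larger. -/

lemma integral_cexp_gaussianReal :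
    ∫ x, Complex.exp (t * x * Complex.I) ∂(gaussianReal μ v)
      = Complex.exp (t * μ * Complex.I - v * t ^ 2 / 2) := by
  rw [← charFun_gaussianReal, charFun_apply_real]

lemma integrable_cexp_gaussianReal :
    Integrable (fun x : ℝ => Complex.exp (t * x * Complex.I)) (gaussianReal μ v) := by
  refine Integrable.of_bound (by fun_prop) 1 (.of_forall fun x => ?_)
  rw [← Complex.ofReal_mul, Complex.norm_exp_ofReal_mul_I]

lemma integral_cos_gaussianReal :
    ∫ x, Real.cos (t * x) ∂(gaussianReal μ v) = Real.exp (-(v * t ^ 2 / 2)) * Real.cos (t * μ) := by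
  have h := congrArg Complex.re (integral_cexp_gaussianReal μ v t)
  have h2 := integral_re (𝕜 := ℂ) (integrable_cexp_gaussianReal μ v t)
  simp only [RCLike.re_to_complex] at h2
  rw [← h2] at h
  simpa [Complex.exp_re, pow_two, ← Complex.ofReal_mul] using h

lemma integral_sin_gaussianReal :
    ∫ x, Real.sin (t * x) ∂(gaussianReal μ v) = Real.exp (-(v * t ^ 2 / 2)) * Real.sin (t * μ) := by
  have h := congrArg Complex.im (integral_cexp_gaussianReal μ v t)
  have h2 := integral_im (𝕜 := ℂ) (integrable_cexp_gaussianReal μ v t)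
  simp only [RCLike.im_to_complex] at h2
  rw [← h2] at h
  simpa [Complex.exp_re, Complex.exp_im, pow_two, ← Complex.ofReal_mul] using h

lemma gaussianPDFReal_zero_one (x : ℝ) :
    gaussianPDFReal 0 1 x = (√(2 * Real.pi))⁻¹ * Real.exp (-(x ^ 2 / 2)) := by
  simp [gaussianPDFReal, neg_div]

lemma integrableOn_exp_neg_sq_div_two (T : ℝ) :
    IntegrableOn (fun t : ℝ => Real.exp (-(t ^ 2 / 2))) (Set.Ioi T) := by
  have := integrable_exp_neg_mul_sq (b := 1 / 2) (by norm_num)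
  refine (this.congr (.of_forall fun x => ?_)).integrableOn
  ring_nf

/-- Fourier inversion for the standard normal density. -/
lemma gaussianPDFReal_eq_integral_cos (z : ℝ) :
    gaussianPDFReal 0 1 z
      = (1 / Real.pi) * ∫ t in Set.Ioi (0 : ℝ), Real.exp (-(t ^ 2 / 2)) * Real.cos (t * z) := by
  -- The normal density is a multiple of its own characteristic function, so inversion is this
  -- formula with `z` as the frequency, folded to the half-line by evenness.
  have h := integral_cos_gaussianReal 0 1 z
  rw [integral_gaussianReal_eq_integral_smul one_ne_zero] at h
  have h3 := integral_comp_abs (f := fun t : ℝ => Real.exp (-(t ^ 2 / 2)) * Real.cos (t * z))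
  have h4 : ∀ t : ℝ, gaussianPDFReal 0 1 t • Real.cos (z * t)
      = (√(2 * Real.pi))⁻¹ * (Real.exp (-(|t| ^ 2 / 2)) * Real.cos (|t| * z)) := by
    intro t
    rw [gaussianPDFReal_zero_one, sq_abs, smul_eq_mul, mul_assoc]
    congr 2
    rcases abs_choice t with h | h <;> rw [h]
    · rw [mul_comm]
    · rw [neg_mul, Real.cos_neg, mul_comm]
  simp only [h4] at h
  rw [integral_const_mul, h3] at h
  simp only [NNReal.coe_one, one_mul, mul_zero, Real.cos_zero, mul_one] at h
  rw [gaussianPDFReal_zero_one, ← h]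
  have : (√(2 * Real.pi))⁻¹ * (√(2 * Real.pi))⁻¹ = (2 * Real.pi)⁻¹ := by
    rw [← mul_inv, Real.mul_self_sqrt (by positivity)]
  rw [← mul_assoc, this]
  generalize ∫ t in Set.Ioi (0 : ℝ), Real.exp (-(t ^ 2 / 2)) * Real.cos (t * z) = I
  field_simp

end GaussianTransform

/-! ### The sinc kernel: its size and its smoothing bias -/

section SincKernel

/-- The kernel whose Fourier transform is the indicator of `[-T, T]`. -/
noncomputable def sincKernel (T x : ℝ) : ℝ :=
  (1 / Real.pi) * ∫ t in Set.Ioc 0 T, Real.cos (t * x)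

lemma mul_sincKernel {T : ℝ} (hT : 0 ≤ T) (x : ℝ) :
    x * sincKernel T x = Real.sin (T * x) / Real.pi := by
  rcases eq_or_ne x 0 with rfl | hx
  · simp
  · rw [sincKernel, ← intervalIntegral.integral_of_le hT,
      intervalIntegral.integral_comp_mul_right (fun y => Real.cos y) hx, integral_cos]
    simp
    field_simp

lemma abs_sincKernel_le {T : ℝ} (hT : 0 ≤ T) (x : ℝ) : |sincKernel T x| ≤ T / Real.pi := by
  have h : ‖∫ t in Set.Ioc 0 T, Real.cos (t * x)‖ ≤ 1 * volume.real (Set.Ioc 0 T) :=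
    norm_setIntegral_le_of_norm_le_const (by simp) fun t _ => Real.abs_cos_le_one _
  rw [sincKernel, abs_mul, abs_of_pos (by positivity : 0 < 1 / Real.pi)]
  simp only [Real.norm_eq_abs, Real.volume_real_Ioc, sub_zero, one_mul, max_eq_left hT] at h
  calc _ ≤ 1 / Real.pi * T := by gcongr
    _ = _ := by ring

lemma measurable_sincKernel (T : ℝ) : Measurable (sincKernel T) := by
  have : StronglyMeasurable fun x : ℝ => ∫ t in Set.Ioc 0 T, Real.cos (t * x) :=
    StronglyMeasurable.integral_prod_right'
      (f := fun p : ℝ × ℝ => Real.cos (p.2 * p.1)) (by fun_prop)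
  exact this.measurable.const_mul _

/-- The bounds `T/π` on the kernel and `1/π` on `x` times the kernel combine into a Cauchy majorant,
which gives the right order in `T` without Plancherel. -/
lemma sincKernel_sq_le {T : ℝ} (hT : 0 ≤ T) (x : ℝ) :
    sincKernel T x ^ 2 ≤ (2 * T ^ 2 / Real.pi ^ 2) * (1 + (T * x) ^ 2)⁻¹ := by
  have h1 : sincKernel T x ^ 2 ≤ (T / Real.pi) ^ 2 :=
    sq_le_sq' (neg_le_of_abs_le (abs_sincKernel_le hT x)) (le_of_abs_le (abs_sincKernel_le hT x))
  have h2 : (x * sincKernel T x) ^ 2 ≤ (1 / Real.pi) ^ 2 := by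
    rw [mul_sincKernel hT, div_pow, div_pow]
    have := Real.sin_sq_le_one (T * x)
    exact div_le_div_of_nonneg_right (by simpa using this) (by positivity)
  rw [← div_eq_mul_inv, le_div_iff₀ (by positivity)]
  calc sincKernel T x ^ 2 * (1 + (T * x) ^ 2)
      = sincKernel T x ^ 2 + T ^ 2 * (x * sincKernel T x) ^ 2 := by ring
    _ ≤ (T / Real.pi) ^ 2 + T ^ 2 * (1 / Real.pi) ^ 2 := by gcongr
    _ = _ := by ring

lemma lintegral_sincKernel_sq_le {T : ℝ} (hT : 0 < T) :
    ∫⁻ x, ENNReal.ofReal (sincKernel T x ^ 2) ≤ ENNReal.ofReal T := by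
  have hi : Integrable fun x : ℝ => (2 * T ^ 2 / Real.pi ^ 2) * (1 + (T * x) ^ 2)⁻¹ :=
    ((integrable_comp_mul_left_iff (fun x : ℝ => (1 + x ^ 2)⁻¹) hT.ne').2
      integrable_inv_one_add_sq).const_mul _
  calc ∫⁻ x, ENNReal.ofReal (sincKernel T x ^ 2)
      ≤ ∫⁻ x, ENNReal.ofReal ((2 * T ^ 2 / Real.pi ^ 2) * (1 + (T * x) ^ 2)⁻¹) :=
        lintegral_mono fun x => ENNReal.ofReal_le_ofReal (sincKernel_sq_le hT.le x)
    _ = ENNReal.ofReal (2 * T / Real.pi) := by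
        rw [← ofReal_integral_eq_lintegral_ofReal hi (.of_forall fun x => by positivity),
          integral_const_mul, Measure.integral_comp_mul_left (fun x : ℝ => (1 + x ^ 2)⁻¹),
          integral_univ_inv_one_add_sq, abs_of_pos (by positivity)]
        congr 1
        simp
        field_simp
    _ ≤ ENNReal.ofReal T := by
        refine ENNReal.ofReal_le_ofReal ?_
        rw [div_le_iff₀ Real.pi_pos]
        nlinarith [Real.pi_gt_three]

/-- The smoothing bias of the kernel at the standard normal density. -/
noncomputable def sincBias (T z : ℝ) : ℝ :=
  ∫ y, sincKernel T (z - y) ∂(gaussianReal 0 1) - gaussianPDFReal 0 1 z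

lemma integral_sincKernel_gaussianReal (T z : ℝ) :
    ∫ y, sincKernel T (z - y) ∂(gaussianReal 0 1)
      = (1 / Real.pi) * ∫ t in Set.Ioc 0 T, Real.exp (-(t ^ 2 / 2)) * Real.cos (t * z) := by
  simp only [sincKernel]
  rw [integral_const_mul, integral_integral_swap]
  · congr 1
    refine integral_congr_ae (.of_forall fun t => ?_)
    have h := integral_cos_gaussianReal z 1 t
    have hm := gaussianReal_map_const_sub (μ := 0) (v := 1) z
    rw [sub_zero] at hm
    rw [← hm, integral_map (by fun_prop) (by fun_prop)] at h
    simpa using h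
  · refine Integrable.of_bound (Measurable.aestronglyMeasurable (by
      unfold Function.uncurry; fun_prop)) 1 (.of_forall fun x => ?_)
    exact Real.abs_cos_le_one _

/-- Smoothing truncates the inversion integral at frequency `T`; the bias is minus the discarded
tail. -/
lemma sincBias_eq {T : ℝ} (hT : 0 ≤ T) (z : ℝ) :
    sincBias T z
      = -((1 / Real.pi) * ∫ t in Set.Ioi T, Real.exp (-(t ^ 2 / 2)) * Real.cos (t * z)) := by
  rw [sincBias, integral_sincKernel_gaussianReal, gaussianPDFReal_eq_integral_cos]
  have hint : IntegrableOn (fun t : ℝ => Real.exp (-(t ^ 2 / 2)) * Real.cos (t * z)) (Set.Ioi 0) := by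
    refine (integrableOn_exp_neg_sq_div_two 0).mul_bdd (c := 1) (by fun_prop)
      (.of_forall fun t => Real.abs_cos_le_one _)
  rw [← Set.Ioc_union_Ioi_eq_Ioi hT, setIntegral_union (Set.Ioc_disjoint_Ioi le_rfl)
    measurableSet_Ioi (hint.mono_set Set.Ioc_subset_Ioi_self)
    (hint.mono_set (Set.Ioi_subset_Ioi hT))]
  ring

lemma tendsto_exp_neg_sq_div_two :
    Filter.Tendsto (fun t : ℝ => Real.exp (-(t ^ 2 / 2))) Filter.atTop (nhds 0) := by
  refine Real.tendsto_exp_atBot.comp (Filter.tendsto_neg_atTop_atBot.comp ?_)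
  exact (Filter.tendsto_pow_atTop two_ne_zero).atTop_div_const two_pos

lemma hasDerivAt_exp_neg_sq_div_two (t : ℝ) :
    HasDerivAt (fun t : ℝ => Real.exp (-(t ^ 2 / 2))) (-(t * Real.exp (-(t ^ 2 / 2)))) t := by
  have := (((hasDerivAt_pow 2 t).div_const 2).neg).exp
  refine this.congr_deriv ?_
  simp
  ring

lemma integrableOn_mul_exp_neg_sq_div_two (T : ℝ) :
    IntegrableOn (fun t : ℝ => t * Real.exp (-(t ^ 2 / 2))) (Set.Ioi T) := by
  have := integrable_mul_exp_neg_mul_sq (b := 1 / 2) (by norm_num)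
  refine (this.congr (.of_forall fun x => ?_)).integrableOn
  ring_nf

lemma integral_mul_exp_neg_sq_div_two (T : ℝ) :
    ∫ t in Set.Ioi T, t * Real.exp (-(t ^ 2 / 2)) = Real.exp (-(T ^ 2 / 2)) := by
  have h := integral_Ioi_of_hasDerivAt_of_tendsto' (a := T)
    (fun t _ => hasDerivAt_exp_neg_sq_div_two t) (integrableOn_mul_exp_neg_sq_div_two T).neg
    tendsto_exp_neg_sq_div_two
  rw [integral_neg] at h
  linarith

lemma abs_sincBias_le {T : ℝ} (hT : 1 ≤ T) (z : ℝ) :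
    |sincBias T z| ≤ Real.exp (-(T ^ 2 / 2)) := by
  have h : ‖∫ t in Set.Ioi T, Real.exp (-(t ^ 2 / 2)) * Real.cos (t * z)‖
      ≤ ∫ t in Set.Ioi T, t * Real.exp (-(t ^ 2 / 2)) := by
    -- Since `t ≥ T ≥ 1`, a factor `t` may be inserted, and the majorant then has an explicit
    -- primitive.
    refine norm_integral_le_of_norm_le (integrableOn_mul_exp_neg_sq_div_two T)
      ((ae_restrict_iff' measurableSet_Ioi).2 (.of_forall fun t ht => ?_))
    have ht' : 1 ≤ t := hT.trans (le_of_lt ht)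
    rw [norm_mul, Real.norm_eq_abs, Real.abs_exp, mul_comm]
    gcongr
    exact (Real.abs_cos_le_one _).trans ht'
  rw [integral_mul_exp_neg_sq_div_two, Real.norm_eq_abs] at h
  rw [sincBias_eq (by linarith), abs_neg, abs_mul, abs_of_pos (by positivity : 0 < 1 / Real.pi)]
  have hpi : 1 / Real.pi ≤ 1 := by
    rw [div_le_one Real.pi_pos]; linarith [Real.pi_gt_three]
  calc _ ≤ 1 * Real.exp (-(T ^ 2 / 2)) := by gcongr
    _ = _ := one_mul _

/-- Integration by parts in the frequency trades the factor `z` for a boundary term and a derivative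
of the Gaussian. The resulting decay in `z` makes the bias square integrable with norm of order
`exp(-T²/2)`. -/
lemma abs_mul_sincBias_le {T : ℝ} (hT : 1 ≤ T) (z : ℝ) :
    |z * sincBias T z| ≤ Real.exp (-(T ^ 2 / 2)) := by
  have hd : ∀ t : ℝ, HasDerivAt (fun t : ℝ => Real.exp (-(t ^ 2 / 2)) * Real.sin (t * z))
      (z * (Real.exp (-(t ^ 2 / 2)) * Real.cos (t * z))
        - t * Real.exp (-(t ^ 2 / 2)) * Real.sin (t * z)) t := fun t => by
    refine ((hasDerivAt_exp_neg_sq_div_two t).mul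
      (((hasDerivAt_id t).mul_const z).sin)).congr_deriv ?_
    simp
    ring
  have hi1 : IntegrableOn (fun t : ℝ => z * (Real.exp (-(t ^ 2 / 2)) * Real.cos (t * z)))
      (Set.Ioi T) :=
    ((integrableOn_exp_neg_sq_div_two T).mul_bdd (c := 1) (by fun_prop)
      (.of_forall fun t => Real.abs_cos_le_one _)).const_mul z
  have hi2 : IntegrableOn (fun t : ℝ => t * Real.exp (-(t ^ 2 / 2)) * Real.sin (t * z))
      (Set.Ioi T) :=
    (integrableOn_mul_exp_neg_sq_div_two T).mul_bdd (c := 1) (by fun_prop)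
      (.of_forall fun t => Real.abs_sin_le_one _)
  have hlim : Filter.Tendsto (fun t : ℝ => Real.exp (-(t ^ 2 / 2)) * Real.sin (t * z))
      Filter.atTop (nhds 0) := by
    refine squeeze_zero_norm (fun t => ?_) tendsto_exp_neg_sq_div_two
    rw [norm_mul, Real.norm_eq_abs, Real.abs_exp]
    exact mul_le_of_le_one_right (Real.exp_pos _).le (Real.abs_sin_le_one _)
  have h := integral_Ioi_of_hasDerivAt_of_tendsto' (a := T) (fun t _ => hd t) (hi1.sub hi2) hlim
  rw [integral_sub hi1 hi2, integral_const_mul] at h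
  have h2 : ‖∫ t in Set.Ioi T, t * Real.exp (-(t ^ 2 / 2)) * Real.sin (t * z)‖
      ≤ ∫ t in Set.Ioi T, t * Real.exp (-(t ^ 2 / 2)) := by
    refine norm_integral_le_of_norm_le (integrableOn_mul_exp_neg_sq_div_two T)
      ((ae_restrict_iff' measurableSet_Ioi).2 (.of_forall fun t ht => ?_))
    have ht' : 0 ≤ t := by linarith [Set.mem_Ioi.1 ht]
    rw [norm_mul, norm_mul, Real.norm_eq_abs, Real.norm_eq_abs, Real.abs_exp, abs_of_nonneg ht']
    exact mul_le_of_le_one_right (by positivity) (Real.abs_sin_le_one _)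
  rw [integral_mul_exp_neg_sq_div_two, Real.norm_eq_abs] at h2
  have h3 : |Real.exp (-(T ^ 2 / 2)) * Real.sin (T * z)| ≤ Real.exp (-(T ^ 2 / 2)) := by
    rw [abs_mul, Real.abs_exp]
    exact mul_le_of_le_one_right (Real.exp_pos _).le (Real.abs_sin_le_one _)
  have e : z * sincBias T z = (1 / Real.pi) * (Real.exp (-(T ^ 2 / 2)) * Real.sin (T * z)
      - ∫ t in Set.Ioi T, t * Real.exp (-(t ^ 2 / 2)) * Real.sin (t * z)) := by
    rw [sincBias_eq (by linarith)]
    linear_combination (-(1 / Real.pi)) * h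
  rw [e, abs_mul, abs_of_pos (by positivity : 0 < 1 / Real.pi), one_div, inv_mul_le_iff₀ Real.pi_pos]
  refine (abs_sub _ _).trans ?_
  nlinarith [Real.pi_gt_three, Real.exp_pos (-(T ^ 2 / 2))]

lemma lintegral_sincBias_sq_le {T : ℝ} (hT : 1 ≤ T) :
    ∫⁻ z, ENNReal.ofReal (sincBias T z ^ 2) ≤ ENNReal.ofReal (2 * Real.pi * Real.exp (-(T ^ 2))) := by
  have hb : ∀ z, sincBias T z ^ 2 ≤ 2 * Real.exp (-(T ^ 2)) * (1 + z ^ 2)⁻¹ := by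
    intro z
    rw [← div_eq_mul_inv, le_div_iff₀ (by positivity)]
    have h1 := sq_le_sq.2 ((abs_sincBias_le hT z).trans (le_abs_self _))
    have h2 := sq_le_sq.2 ((abs_mul_sincBias_le hT z).trans (le_abs_self _))
    have he : Real.exp (-(T ^ 2 / 2)) ^ 2 = Real.exp (-(T ^ 2)) := by
      rw [← Real.exp_nat_mul]; congr 1; push_cast; ring
    rw [he] at h1 h2
    nlinarith
  calc _ ≤ ∫⁻ z : ℝ, ENNReal.ofReal (2 * Real.exp (-(T ^ 2)) * (1 + z ^ 2)⁻¹) :=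
        lintegral_mono fun z => ENNReal.ofReal_le_ofReal (hb z)
    _ = _ := by
        rw [← ofReal_integral_eq_lintegral_ofReal (integrable_inv_one_add_sq.const_mul _)
          (.of_forall fun x => by positivity), integral_const_mul, integral_univ_inv_one_add_sq]
        congr 1
        ring

end SincKernel

/-! ### Mixtures as convolutions of measures -/

section MixtureLaw

lemma normalMixture_nonneg (Pi : Measure ℝ) (x : ℝ) : 0 ≤ normalMixture Pi x :=
  integral_nonneg fun _ => gaussianPDFReal_nonneg _ _ _

lemma gaussianPDFReal_sub_zero (x u : ℝ) : gaussianPDFReal 0 1 (x - u) = gaussianPDFReal u 1 x := by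
  simp [gaussianPDFReal]

lemma gaussianPDFReal_zero_one_le (x : ℝ) : gaussianPDFReal 0 1 x ≤ 1 := by
  rw [gaussianPDFReal_zero_one]
  refine mul_le_one₀ (inv_le_one_of_one_le₀ (Real.one_le_sqrt.2 ?_)) (Real.exp_pos _).le
    (Real.exp_le_one_iff.2 (by nlinarith [sq_nonneg x]))
  linarith [Real.pi_gt_three]

lemma integrable_gaussianPDFReal_sub (Pi : Measure ℝ) [IsFiniteMeasure Pi] (x : ℝ) :
    Integrable (fun u => gaussianPDFReal 0 1 (x - u)) Pi := by
  refine Integrable.of_bound ((measurable_gaussianPDFReal 0 1).comp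
    (measurable_const.sub measurable_id)).aestronglyMeasurable 1 (.of_forall fun u => ?_)
  rw [Real.norm_eq_abs, abs_of_nonneg (gaussianPDFReal_nonneg _ _ _)]
  exact gaussianPDFReal_zero_one_le _

lemma ofReal_normalMixture (Pi : Measure ℝ) [IsFiniteMeasure Pi] (x : ℝ) :
    ENNReal.ofReal (normalMixture Pi x) = ∫⁻ u, gaussianPDF u 1 x ∂Pi := by
  rw [normalMixture, ofReal_integral_eq_lintegral_ofReal (integrable_gaussianPDFReal_sub Pi x)
    (.of_forall fun _ => gaussianPDFReal_nonneg _ _ _)]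
  simp only [gaussianPDFReal_sub_zero, gaussianPDF]

lemma measurable_gaussianPDF_prod :
    Measurable fun p : ℝ × ℝ => gaussianPDF p.1 1 p.2 :=
  measurable_uncurry_gaussianPDF.comp
    (measurable_fst.prodMk (measurable_const.prodMk measurable_snd))

lemma densityLaw_normalMixture (Pi : Measure ℝ) [IsFiniteMeasure Pi] :
    densityLaw (normalMixture Pi) = Pi.conv (gaussianReal 0 1) := by
  ext s hs
  rw [densityLaw, withDensity_apply _ hs]
  simp only [ofReal_normalMixture]
  rw [lintegral_lintegral_swap, ← lintegral_indicator_one hs,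
    Measure.lintegral_conv (measurable_one.indicator hs)]
  · refine lintegral_congr fun u => ?_
    have hm := gaussianReal_map_const_add (μ := 0) (v := 1) u
    rw [zero_add] at hm
    rw [← lintegral_map (μ := gaussianReal 0 1) (f := s.indicator (1 : ℝ → ℝ≥0∞))
      (measurable_one.indicator hs) (measurable_const_add u), hm, lintegral_indicator_one hs,
      gaussianReal_apply _ one_ne_zero]
  · exact (measurable_gaussianPDF_prod.comp measurable_swap).aemeasurable

instance isProbabilityMeasure_densityLaw_normalMixture (Pi : Measure ℝ) [IsProbabilityMeasure Pi] :
    IsProbabilityMeasure (densityLaw (normalMixture Pi)) := by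
  rw [densityLaw_normalMixture]; infer_instance

end MixtureLaw

/-! ### Risk of kernel estimators and the upper bound -/

section KernelEstimator

/-- The kernel density estimator with kernel `K`. -/
noncomputable def kernelEstimator (K : ℝ → ℝ) (n : ℕ) (X : Fin n → ℝ) (x : ℝ) : ℝ :=
  (n : ℝ)⁻¹ * ∑ i, K (x - X i)

lemma isEstimator_kernelEstimator {K : ℝ → ℝ} (hK : Measurable K) (n : ℕ) :
    IsEstimator n (kernelEstimator K n) := by
  unfold IsEstimator Function.uncurry kernelEstimator
  fun_prop

lemma integral_sq_sub_const {Ω : Type*} [MeasurableSpace Ω] {P : Measure Ω}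
    [IsProbabilityMeasure P] {Y : Ω → ℝ} (hY : MemLp Y 2 P) (c : ℝ) :
    ∫ ω, (Y ω - c) ^ 2 ∂P = Var[Y; P] + ((∫ ω, Y ω ∂P) - c) ^ 2 := by
  have h := variance_eq_sub (hY.sub (memLp_const c))
  have h2 : Var[Y - fun _ => c; P] = Var[Y; P] := variance_sub_const hY.aestronglyMeasurable c
  rw [h2] at h
  have h3 : ∫ ω, (Y - (fun _ => c : Ω → ℝ)) ω ∂P = ∫ ω, Y ω ∂P - c := by
    simp only [Pi.sub_apply]
    rw [integral_sub (hY.integrable one_le_two) (integrable_const c)]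
    simp
  rw [h3] at h
  rw [h]
  simp

/-- Mean squared error of an empirical mean. -/
lemma integral_sq_mean_sub_le {n : ℕ} (hn : n ≠ 0) {μ : Measure ℝ} [IsProbabilityMeasure μ]
    {g : ℝ → ℝ} (hg : MemLp g 2 μ) (c : ℝ) :
    ∫ X, ((n : ℝ)⁻¹ * ∑ i, g (X i) - c) ^ 2 ∂(Measure.pi fun _ : Fin n => μ)
      ≤ (n : ℝ)⁻¹ * (∫ y, g y ^ 2 ∂μ) + ((∫ y, g y ∂μ) - c) ^ 2 := by
  have hgi : ∀ i : Fin n, MemLp (fun X : Fin n → ℝ => g (X i)) 2 (Measure.pi fun _ => μ) :=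
    fun i => hg.comp_measurePreserving (measurePreserving_eval (fun _ : Fin n => μ) i)
  have hS : MemLp (∑ i, fun X : Fin n → ℝ => g (X i)) 2 (Measure.pi fun _ => μ) :=
    memLp_finsetSum' _ fun i _ => hgi i
  have hint : ∀ i : Fin n, ∫ X : Fin n → ℝ, g (X i) ∂(Measure.pi fun _ => μ) = ∫ y, g y ∂μ :=
    fun i => integral_comp_eval (μ := fun _ : Fin n => μ) hg.aestronglyMeasurable
  have hn' : (n : ℝ) ≠ 0 := Nat.cast_ne_zero.2 hn
  have h := integral_sq_sub_const (hS.const_mul (n : ℝ)⁻¹) c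
  have hvar : Var[fun X => (n : ℝ)⁻¹ * (∑ i, fun X : Fin n → ℝ => g (X i)) X;
      Measure.pi fun _ => μ] = (n : ℝ)⁻¹ * Var[g; μ] := by
    rw [variance_const_mul, variance_sum_pi (fun _ => hg)]
    simp
    field_simp
  have hmean : ∫ X, (n : ℝ)⁻¹ * (∑ i, fun X : Fin n → ℝ => g (X i)) X ∂(Measure.pi fun _ => μ)
      = ∫ y, g y ∂μ := by
    rw [integral_const_mul]
    simp only [Finset.sum_apply]
    rw [integral_finsetSum _ fun i _ => (hgi i).integrable one_le_two]
    simp [hint, hn']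
  rw [hvar, hmean] at h
  simp only [Finset.sum_apply] at h
  rw [h]
  gcongr
  exact variance_le_expectation_sq hg.aestronglyMeasurable

/-- Bias–variance bound for the kernel estimator of a normal mixture. -/
lemma risk_kernelEstimator_le {K : ℝ → ℝ} (hK : Measurable K) {M : ℝ} (hM : ∀ x, |K x| ≤ M)
    {n : ℕ} (hn : n ≠ 0) (Pi : Measure ℝ) [IsProbabilityMeasure Pi] :
    risk n (kernelEstimator K n) (normalMixture Pi)
      ≤ ENNReal.ofReal (n : ℝ)⁻¹ * (∫⁻ x, ENNReal.ofReal (K x ^ 2))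
        + ∫⁻ z, ENNReal.ofReal
            ((∫ y, K (z - y) ∂(gaussianReal 0 1) - gaussianPDFReal 0 1 z) ^ 2) := by
  set f := normalMixture Pi with hf
  set μ := densityLaw f with hμ
  have : IsProbabilityMeasure μ := isProbabilityMeasure_densityLaw_normalMixture Pi
  have : IsProbabilityMeasure (sampleLaw n f) := by
    unfold sampleLaw; infer_instance
  set D : ℝ → ℝ := fun z => ∫ y, K (z - y) ∂(gaussianReal 0 1) - gaussianPDFReal 0 1 z with hD
  have hDm : Measurable D := by
    have : StronglyMeasurable fun z : ℝ => ∫ y, K (z - y) ∂(gaussianReal 0 1) :=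
      StronglyMeasurable.integral_prod_right'
        (f := fun p : ℝ × ℝ => K (p.1 - p.2)) (by fun_prop)
    exact this.measurable.sub (measurable_gaussianPDFReal 0 1)
  have hM0 : 0 ≤ M := (abs_nonneg _).trans (hM 0)
  have hDb : ∀ z, ‖D z‖ ≤ M + 1 := by
    intro z
    refine (norm_sub_le _ _).trans (add_le_add ?_ ?_)
    · simpa using norm_integral_le_of_norm_le_const (μ := gaussianReal 0 1)
        (f := fun y => K (z - y)) (.of_forall fun y => hM (z - y))
    · rw [Real.norm_eq_abs, abs_of_nonneg (gaussianPDFReal_nonneg _ _ _)]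
      exact gaussianPDFReal_zero_one_le z
  have hKp : ∀ x : ℝ, MemLp (fun y => K (x - y)) 2 μ := fun x =>
    MemLp.of_bound (hK.comp (measurable_const.sub measurable_id)).aestronglyMeasurable M
      (.of_forall fun y => hM _)
  -- The bias is linear in the mixing measure, hence an average of translates of the bias `D` at the
  -- normal density.
  have hbias : ∀ x, ∫ y, K (x - y) ∂μ - f x = ∫ u, D (x - u) ∂Pi := by
    intro x
    have hc : Integrable (fun y => K (x - y)) (Pi.conv (gaussianReal 0 1)) := by
      rw [← densityLaw_normalMixture]
      exact (hKp x).integrable one_le_two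
    rw [hμ, hf, densityLaw_normalMixture, integral_conv hc, normalMixture, ← integral_sub]
    · simp only [hD, sub_sub]
    · refine Integrable.of_bound (StronglyMeasurable.integral_prod_right'
        (f := fun p : ℝ × ℝ => K (x - (p.1 + p.2))) (by fun_prop)).aestronglyMeasurable M
        (.of_forall fun u => ?_)
      simpa using norm_integral_le_of_norm_le_const (μ := gaussianReal 0 1)
        (f := fun y => K (x - (u + y))) (.of_forall fun y => hM (x - (u + y)))
    · exact integrable_gaussianPDFReal_sub Pi x
  have hfm : Measurable f := by
    refine (StronglyMeasurable.integral_prod_right'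
      (f := fun p : ℝ × ℝ => gaussianPDFReal 0 1 (p.1 - p.2)) ?_).measurable
    exact ((measurable_gaussianPDFReal 0 1).comp (by fun_prop)).stronglyMeasurable
  have hpt : ∀ x, ∫⁻ X, ENNReal.ofReal ((kernelEstimator K n X x - f x) ^ 2) ∂(sampleLaw n f)
      ≤ ENNReal.ofReal (n : ℝ)⁻¹ * (∫⁻ y, ENNReal.ofReal (K (x - y) ^ 2) ∂μ)
        + ∫⁻ u, ENNReal.ofReal (D (x - u) ^ 2) ∂Pi := by
    intro x
    have hD2 : MemLp (fun u => D (x - u)) 2 Pi :=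
      MemLp.of_bound (hDm.comp (measurable_const.sub measurable_id)).aestronglyMeasurable (M + 1)
        (.of_forall fun y => hDb _)
    have hs : MemLp (fun X : Fin n → ℝ => kernelEstimator K n X x - f x) 2 (sampleLaw n f) := by
      refine MemLp.of_bound (Measurable.aestronglyMeasurable ?_) (M + |f x|)
        (.of_forall fun X => ?_)
      · unfold kernelEstimator; fun_prop
      · refine (norm_sub_le _ _).trans (add_le_add ?_ le_rfl)
        rw [kernelEstimator, norm_mul, norm_inv, Real.norm_natCast,
          inv_mul_le_iff₀ (by positivity)]
        refine (norm_sum_le _ _).trans ((Finset.sum_le_sum fun i _ => hM _).trans ?_)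
        simp
    rw [← ofReal_integral_eq_lintegral_ofReal hs.integrable_sq (.of_forall fun _ => sq_nonneg _),
      ← ofReal_integral_eq_lintegral_ofReal (hKp x).integrable_sq (.of_forall fun _ => sq_nonneg _),
      ← ofReal_integral_eq_lintegral_ofReal hD2.integrable_sq (.of_forall fun _ => sq_nonneg _),
      ← ENNReal.ofReal_mul (by positivity), ← ENNReal.ofReal_add (by positivity) (by positivity)]
    refine ENNReal.ofReal_le_ofReal ((integral_sq_mean_sub_le hn (hKp x) (f x)).trans ?_)
    rw [hbias]
    gcongr
    -- Jensen's inequality for the square, as nonnegativity of a variance.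
    have h1 := variance_nonneg (fun u => D (x - u)) Pi
    rw [variance_eq_sub hD2] at h1
    simpa using h1
  calc risk n (kernelEstimator K n) f
      = ∫⁻ x, ∫⁻ X, ENNReal.ofReal ((kernelEstimator K n X x - f x) ^ 2) ∂(sampleLaw n f) := by
        unfold risk sqLoss
        rw [lintegral_lintegral_swap]
        have := isEstimator_kernelEstimator hK n
        unfold IsEstimator at this
        exact ((this.sub (hfm.comp measurable_snd)).pow_const 2).ennreal_ofReal.aemeasurable
    _ ≤ ∫⁻ x, (ENNReal.ofReal (n : ℝ)⁻¹ * (∫⁻ y, ENNReal.ofReal (K (x - y) ^ 2) ∂μ)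
        + ∫⁻ u, ENNReal.ofReal (D (x - u) ^ 2) ∂Pi) := lintegral_mono hpt
    _ = _ := by
        -- Tonelli and translation invariance remove the averaging measure, so the bound no longer
        -- depends on `Pi`.
        have key : ∀ (ν : Measure ℝ) [IsProbabilityMeasure ν] (g : ℝ → ℝ), Measurable g →
            ∫⁻ x, ∫⁻ y, ENNReal.ofReal (g (x - y) ^ 2) ∂ν = ∫⁻ x, ENNReal.ofReal (g x ^ 2) := by
          intro ν _ g hg
          rw [lintegral_lintegral_swap (by unfold Function.uncurry; fun_prop)]
          simp_rw [lintegral_sub_right_eq_self (fun x => ENNReal.ofReal (g x ^ 2))]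
          simp
        have hm1 : Measurable fun x => ∫⁻ y, ENNReal.ofReal (K (x - y) ^ 2) ∂μ :=
          Measurable.lintegral_prod_right'
            (f := fun p : ℝ × ℝ => ENNReal.ofReal (K (p.1 - p.2) ^ 2)) (by fun_prop)
        rw [lintegral_add_left (hm1.const_mul _), lintegral_const_mul _ hm1, key μ K hK,
          key Pi D hDm]

lemma rate_eq {n : ℕ} (hn : 2 ≤ n) : rate n = √(Real.log n) / n := by
  have hn1 : (1 : ℝ) < n := by exact_mod_cast hn
  have hl : 0 < Real.log n := Real.log_pos hn1
  have h2 : 0 < √(Real.log n) := Real.sqrt_pos.2 hl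
  rw [rate]
  field_simp
  rw [Real.sq_sqrt hl.le]

lemma half_le_sqrt_log {n : ℕ} (hn : 2 ≤ n) : 1 / 2 ≤ √(Real.log n) := by
  have hn1 : (2 : ℝ) ≤ n := by exact_mod_cast hn
  refine Real.le_sqrt_of_sq_le ?_
  have := Real.log_le_log two_pos hn1
  linarith [Real.log_two_gt_d9]

lemma exists_estimator_risk_le :
    ∃ C : ℝ, 0 < C ∧ ∀ n : ℕ, 2 ≤ n →
      ∃ fhat : (Fin n → ℝ) → ℝ → ℝ, IsEstimator n fhat ∧
        (⨆ f ∈ mixtureClass, risk n fhat f) ≤ ENNReal.ofReal (C * rate n) := by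
  refine ⟨20, by norm_num, fun n hn => ?_⟩
  have hn1 : (2 : ℝ) ≤ n := by exact_mod_cast hn
  set s := √(Real.log n) with hs
  have hs2 : 1 / 2 ≤ s := half_le_sqrt_log hn
  -- The `1` secures `T ≥ 1` for the bias bounds, and `T² ≥ log n` brings the squared bias down to
  -- order `1/n`. As `s ≥ 1/2`, the total `9 + s` is at most `20 s`.
  set T := 1 + s with hTdef
  have hT : 1 ≤ T := by linarith
  refine ⟨kernelEstimator (sincKernel T) n, isEstimator_kernelEstimator (measurable_sincKernel T) n,
    iSup₂_le ?_⟩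
  rintro _ ⟨Pi, hPi, rfl⟩
  refine (risk_kernelEstimator_le (measurable_sincKernel T) (abs_sincKernel_le (T := T) (by linarith))
    (by omega) Pi).trans ?_
  refine (add_le_add (mul_le_mul_right (lintegral_sincKernel_sq_le (T := T) (by linarith)) _)
    (lintegral_sincBias_sq_le hT)).trans ?_
  rw [← ENNReal.ofReal_mul (by positivity), ← ENNReal.ofReal_add (by positivity) (by positivity),
    rate_eq hn]
  refine ENNReal.ofReal_le_ofReal ?_
  have he : Real.exp (-T ^ 2) ≤ (n : ℝ)⁻¹ := by
    rw [← Real.exp_log (by positivity : (0 : ℝ) < (n : ℝ)⁻¹), Real.log_inv]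
    refine Real.exp_le_exp.2 ?_
    have : s ^ 2 = Real.log n := Real.sq_sqrt (Real.log_nonneg (by linarith))
    nlinarith
  calc (n : ℝ)⁻¹ * T + 2 * Real.pi * Real.exp (-T ^ 2)
      ≤ (n : ℝ)⁻¹ * T + 2 * 4 * (n : ℝ)⁻¹ := by
        gcongr
        exact Real.pi_le_four
    _ = (n : ℝ)⁻¹ * (9 + s) := by rw [hTdef]; ring
    _ ≤ (n : ℝ)⁻¹ * (20 * s) := by gcongr; linarith
    _ = 20 * (s / n) := by ring

end KernelEstimator

/-! ### Bessel's inequality and the sine system -/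

section Bessel

lemma bessel_of_orthogonal {Ω : Type*} [MeasurableSpace Ω] {μ : Measure Ω} {ι : Type*} [Fintype ι]
    [DecidableEq ι] {e : ι → Ω → ℝ} (he : ∀ j, MemLp (e j) 2 μ) {N : ℝ} (hN : 0 < N)
    (horth : ∀ j k, ∫ x, e j x * e k x ∂μ = if j = k then N else 0)
    {r : Ω → ℝ} (hr : MemLp r 2 μ) :
    N * ∑ j, (N⁻¹ * ∫ x, r x * e j x ∂μ) ^ 2 ≤ ∫ x, r x ^ 2 ∂μ := by
  set c : ι → ℝ := fun j => N⁻¹ * ∫ x, r x * e j x ∂μ with hc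
  have hp : MemLp (fun x => ∑ j, c j * e j x) 2 μ :=
    memLp_finsetSum _ fun j _ => (he j).const_mul (c j)
  have hrc : ∀ j, ∫ x, r x * e j x ∂μ = N * c j := fun j => by
    simp only [hc]; field_simp
  have hre : ∀ j, Integrable (fun x => r x * e j x) μ := fun j => hr.integrable_mul (he j)
  have hee : ∀ j k, Integrable (fun x => e j x * e k x) μ := fun j k => (he j).integrable_mul (he k)
  have hrp : Integrable (fun x => 2 * (r x * ∑ j, c j * e j x)) μ :=
    (hr.integrable_mul hp).const_mul 2
  have hpp : Integrable (fun x => (∑ j, c j * e j x) * ∑ j, c j * e j x) μ := hp.integrable_mul hp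
  have hrs : Integrable (fun x => r x ^ 2 - 2 * (r x * ∑ j, c j * e j x)) μ :=
    hr.integrable_sq.sub hrp
  have h1 : ∫ x, r x * ∑ j, c j * e j x ∂μ = N * ∑ j, c j ^ 2 := by
    simp only [Finset.mul_sum, mul_left_comm (r _)]
    rw [integral_finsetSum _ fun j _ => (hre j).const_mul (c j)]
    refine Finset.sum_congr rfl fun j _ => ?_
    rw [integral_const_mul, hrc]; ring
  have h2 : ∫ x, (∑ j, c j * e j x) * ∑ j, c j * e j x ∂μ = N * ∑ j, c j ^ 2 := by
    simp only [Finset.sum_mul_sum, mul_mul_mul_comm (c _) (e _ _)]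
    rw [integral_finsetSum _ fun j _ => integrable_finsetSum _ fun k _ =>
      (hee j k).const_mul (c j * c k), Finset.mul_sum]
    refine Finset.sum_congr rfl fun j _ => ?_
    rw [integral_finsetSum _ fun k _ => (hee j k).const_mul (c j * c k)]
    simp only [integral_const_mul, horth, mul_ite, mul_zero, Finset.sum_ite_eq, Finset.mem_univ,
      if_true]
    ring
  have h3 : 0 ≤ ∫ x, (r x - ∑ j, c j * e j x) ^ 2 ∂μ := integral_nonneg fun _ => sq_nonneg _
  have h4 : ∫ x, (r x - ∑ j, c j * e j x) ^ 2 ∂μ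
      = ∫ x, r x ^ 2 ∂μ - 2 * ∫ x, r x * ∑ j, c j * e j x ∂μ
        + ∫ x, (∑ j, c j * e j x) * ∑ j, c j * e j x ∂μ := by
    rw [← integral_const_mul, ← integral_sub hr.integrable_sq hrp, ← integral_add hrs hpp]
    refine integral_congr_ae (.of_forall fun x => ?_)
    dsimp only
    ring
  rw [h4, h1, h2] at h3
  linarith

lemma integral_cos_int_mul_half (p : ℤ) :
    ∫ x in (-(2 * Real.pi))..(2 * Real.pi), Real.cos (p * (x / 2))
      = if p = 0 then 4 * Real.pi else 0 := by
  split_ifs with hp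
  · subst hp
    simp
    ring
  · have h : (p : ℝ) / 2 ≠ 0 := by
      simpa using hp
    have e : ∀ x : ℝ, (p : ℝ) * (x / 2) = x * (p / 2) := fun x => by ring
    simp only [e]
    rw [intervalIntegral.integral_comp_mul_right (fun y => Real.cos y) h, integral_cos]
    have e1 : 2 * Real.pi * ((p : ℝ) / 2) = p * Real.pi := by ring
    rw [neg_mul, Real.sin_neg, e1, Real.sin_int_mul_pi]
    simp

/-- The sine system on `[-2π, 2π]`. -/
noncomputable def halfSine {m : ℕ} (j : Fin m) (x : ℝ) : ℝ := Real.sin (((j : ℕ) + 1 : ℝ) * (x / 2))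

lemma abs_halfSine_le {m : ℕ} (j : Fin m) (x : ℝ) : |halfSine j x| ≤ 1 := Real.abs_sin_le_one _

lemma measurable_halfSine {m : ℕ} (j : Fin m) : Measurable (halfSine j) := by
  unfold halfSine; fun_prop

lemma memLp_halfSine {m : ℕ} (j : Fin m) (μ : Measure ℝ) [IsFiniteMeasure μ] :
    MemLp (halfSine j) 2 μ :=
  MemLp.of_bound (measurable_halfSine j).aestronglyMeasurable 1 (.of_forall (abs_halfSine_le j))

/-- The interval carrying one full period of the sine system. -/
noncomputable def window : Measure ℝ := volume.restrict (Set.Ioc (-(2 * Real.pi)) (2 * Real.pi))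

instance : IsFiniteMeasure window := by unfold window; infer_instance

lemma integral_halfSine_mul {m : ℕ} (j k : Fin m) :
    ∫ x, halfSine j x * halfSine k x ∂window = if j = k then 2 * Real.pi else 0 := by
  rw [window, ← intervalIntegral.integral_of_le (by linarith [Real.pi_pos])]
  have e : ∀ x : ℝ, halfSine j x * halfSine k x
      = (1 / 2) * (Real.cos ((((j : ℕ) : ℤ) - ((k : ℕ) : ℤ) : ℤ) * (x / 2))
        - Real.cos ((((j : ℕ) : ℤ) + ((k : ℕ) : ℤ) + 2 : ℤ) * (x / 2))) := by
    intro x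
    unfold halfSine
    push_cast
    have e1 : ((j : ℕ) - (k : ℕ) : ℝ) * (x / 2)
      = ((j : ℕ) + 1 : ℝ) * (x / 2) - ((k : ℕ) + 1 : ℝ) * (x / 2) := by ring
    have e2 : ((j : ℕ) + (k : ℕ) + 2 : ℝ) * (x / 2)
      = ((j : ℕ) + 1 : ℝ) * (x / 2) + ((k : ℕ) + 1 : ℝ) * (x / 2) := by ring
    rw [e1, e2, Real.cos_sub, Real.cos_add]
    ring
  simp only [e]
  rw [intervalIntegral.integral_const_mul, intervalIntegral.integral_sub
    (Continuous.intervalIntegrable (by fun_prop) _ _)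
    (Continuous.intervalIntegrable (by fun_prop) _ _), integral_cos_int_mul_half,
    integral_cos_int_mul_half, if_neg (by omega : ¬((j : ℕ) : ℤ) + ((k : ℕ) : ℤ) + 2 = 0)]
  by_cases h : j = k
  · subst h; simp; ring
  · have : ¬((j : ℕ) : ℤ) - ((k : ℕ) : ℤ) = 0 := by
      intro h'; exact h (Fin.ext (by omega))
    simp [h, this]

end Bessel

/-! ### Two-point lower bounds through the Hellinger affinity -/

section TwoPoint

lemma sampleLaw_eq_withDensity (n : ℕ) {f : ℝ → ℝ} (hf0 : ∀ x, 0 ≤ f x) (hf : Integrable f) :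
    sampleLaw n f
      = (volume : Measure (Fin n → ℝ)).withDensity fun X => ENNReal.ofReal (∏ i, f (X i)) := by
  have : IsFiniteMeasure (densityLaw f) := isFiniteMeasure_withDensity_ofReal hf.2
  refine Measure.pi_eq fun s hs => ?_
  rw [withDensity_apply _ (MeasurableSet.univ_pi hs), volume_pi, Measure.restrict_pi_pi,
    ← ofReal_integral_eq_lintegral_ofReal
      (Integrable.fintype_prod (μ := fun i => volume.restrict (s i)) fun i => hf.restrict)
      (.of_forall fun X => Finset.prod_nonneg fun i _ => hf0 _),
    integral_fintype_prod_eq_prod (μ := fun i => volume.restrict (s i)) (fun _ => f),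
    ENNReal.ofReal_prod_of_nonneg fun i _ => integral_nonneg hf0]
  refine Finset.prod_congr rfl fun i _ => ?_
  rw [densityLaw, withDensity_apply _ (hs i),
    ofReal_integral_eq_lintegral_ofReal hf.restrict (.of_forall hf0)]

/-- After multiplication by `P + Q` the difference of the two sides is a sum of two squares: one
measures the distance of `T` from its optimal value, the other that of `√(P * Q)` from `(P + Q) /
4`. -/
lemma two_point_pointwise (T a b : ℝ) {P Q : ℝ} (hP : 0 ≤ P) (hQ : 0 ≤ Q) :
    (a - b) ^ 2 / 2 * √(P * Q)
      ≤ ((T - a) ^ 2 * P + (T - b) ^ 2 * Q) + (a - b) ^ 2 / 16 * (P + Q) := by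
  rw [Real.sqrt_mul hP]
  obtain ⟨p, hp, rfl⟩ : ∃ p, 0 ≤ p ∧ P = p ^ 2 := ⟨√P, Real.sqrt_nonneg _, (Real.sq_sqrt hP).symm⟩
  obtain ⟨q, hq, rfl⟩ : ∃ q, 0 ≤ q ∧ Q = q ^ 2 := ⟨√Q, Real.sqrt_nonneg _, (Real.sq_sqrt hQ).symm⟩
  rw [Real.sqrt_sq hp, Real.sqrt_sq hq]
  rcases (by positivity : 0 ≤ p ^ 2 + q ^ 2).eq_or_lt with h | h
  · have hp0 : p = 0 := by nlinarith
    have hq0 : q = 0 := by nlinarith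
    simp [hp0, hq0]
  · refine le_of_mul_le_mul_right ?_ h
    have : (((T - a) ^ 2 * p ^ 2 + (T - b) ^ 2 * q ^ 2) + (a - b) ^ 2 / 16 * (p ^ 2 + q ^ 2))
        * (p ^ 2 + q ^ 2) - (a - b) ^ 2 / 2 * (p * q) * (p ^ 2 + q ^ 2)
        = ((T - a) * p ^ 2 + (T - b) * q ^ 2) ^ 2
          + ((a - b) * (p * q - (p ^ 2 + q ^ 2) / 4)) ^ 2 := by ring
    have h2 : 0 ≤ ((T - a) * p ^ 2 + (T - b) * q ^ 2) ^ 2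
          + ((a - b) * (p * q - (p ^ 2 + q ^ 2) / 4)) ^ 2 := by positivity
    linarith

lemma integrable_sqrt_mul {Ω : Type*} [MeasurableSpace Ω] {μ : Measure Ω} {p q : Ω → ℝ}
    (hp0 : ∀ x, 0 ≤ p x) (hq0 : ∀ x, 0 ≤ q x) (hp : Integrable p μ) (hq : Integrable q μ) :
    Integrable (fun x => √(p x * q x)) μ := by
  refine (hp.add hq).mono' (hp.1.aemeasurable.mul hq.1.aemeasurable).sqrt.aestronglyMeasurable
    (.of_forall fun x => ?_)
  rw [Real.norm_eq_abs, abs_of_nonneg (Real.sqrt_nonneg _), Pi.add_apply]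
  refine Real.sqrt_le_iff.2 ⟨add_nonneg (hp0 x) (hq0 x), ?_⟩
  nlinarith [mul_nonneg (hp0 x) (hq0 x), sq_nonneg (p x), sq_nonneg (q x)]

/-- Le Cam's two point bound for the squared error, in terms of the Hellinger affinity. -/
lemma two_point_bound {n : ℕ} {p q : ℝ → ℝ} (hp0 : ∀ x, 0 ≤ p x) (hq0 : ∀ x, 0 ≤ q x)
    (hp : Integrable p) (hq : Integrable q) (hp1 : ∫ x, p x = 1) (hq1 : ∫ x, q x = 1)
    (hA : 1 / 2 ≤ (∫ x, √(p x * q x)) ^ n) {T : (Fin n → ℝ) → ℝ} (hT : Measurable T) (a b : ℝ) :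
    ENNReal.ofReal ((a - b) ^ 2 / 8)
      ≤ (∫⁻ X, ENNReal.ofReal ((T X - a) ^ 2) ∂(sampleLaw n p))
        + ∫⁻ X, ENNReal.ofReal ((T X - b) ^ 2) ∂(sampleLaw n q) := by
  set P : (Fin n → ℝ) → ℝ := fun X => ∏ i, p (X i) with hP
  set Q : (Fin n → ℝ) → ℝ := fun X => ∏ i, q (X i) with hQ
  have hP0 : ∀ X, 0 ≤ P X := fun X => Finset.prod_nonneg fun i _ => hp0 _
  have hQ0 : ∀ X, 0 ≤ Q X := fun X => Finset.prod_nonneg fun i _ => hq0 _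
  have hPi : Integrable P := Integrable.fintype_prod fun _ => hp
  have hQi : Integrable Q := Integrable.fintype_prod fun _ => hq
  have hP1 : ∫ X, P X = 1 := by
    rw [hP, integral_fintype_prod_volume_eq_pow p, hp1, one_pow]
  have hQ1 : ∫ X, Q X = 1 := by
    rw [hQ, integral_fintype_prod_volume_eq_pow q, hq1, one_pow]
  have hS : ∫ X, √(P X * Q X) = (∫ x, √(p x * q x)) ^ n := by
    have e : ∀ X, √(P X * Q X) = ∏ i, √(p (X i) * q (X i)) := fun X => by
      rw [hP, hQ, ← Finset.prod_mul_distrib,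
        Real.sqrt_prod _ fun i _ => mul_nonneg (hp0 _) (hq0 _)]
    simp only [e]
    rw [integral_fintype_prod_volume_eq_pow (fun x => √(p x * q x)), Fintype.card_fin]
  have hSi : Integrable fun X => √(P X * Q X) := integrable_sqrt_mul hP0 hQ0 hPi hQi
  have hw : ∀ (R : (Fin n → ℝ) → ℝ) (_ : Integrable R) (d : ℝ),
      ∫⁻ X, ENNReal.ofReal ((T X - d) ^ 2)
          ∂((volume : Measure (Fin n → ℝ)).withDensity fun X => ENNReal.ofReal (R X))
        = ∫⁻ X, ENNReal.ofReal ((T X - d) ^ 2 * R X) := by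
    intro R hR d
    rw [lintegral_withDensity_eq_lintegral_mul₀ hR.1.aemeasurable.ennreal_ofReal
      (((hT.sub_const d).pow_const 2).ennreal_ofReal.aemeasurable)]
    refine lintegral_congr fun X => ?_
    rw [Pi.mul_apply, mul_comm, ENNReal.ofReal_mul (sq_nonneg _)]
  have hTP : AEMeasurable (fun X => ENNReal.ofReal ((T X - a) ^ 2 * P X)) :=
    (((hT.sub_const a).pow_const 2).aemeasurable.mul hPi.1.aemeasurable).ennreal_ofReal
  have hPQ : Integrable fun X => (a - b) ^ 2 / 16 * (P X + Q X) := (hPi.add hQi).const_mul _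
  rw [sampleLaw_eq_withDensity n hp0 hp, sampleLaw_eq_withDensity n hq0 hq, hw P hPi, hw Q hQi,
    ← lintegral_add_left' hTP]
  -- The padding `(a - b)² / 8` is the integral of the penalty `(a - b)² / 16 * (P + Q)`; adding it
  -- to both sides avoids subtraction in `ℝ≥0∞`.
  refine (ENNReal.add_le_add_iff_right
    (ENNReal.ofReal_ne_top (r := (a - b) ^ 2 / 8))).1 ?_
  calc ENNReal.ofReal ((a - b) ^ 2 / 8) + ENNReal.ofReal ((a - b) ^ 2 / 8)
      = ENNReal.ofReal ((a - b) ^ 2 / 2 * (1 / 2)) := by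
        rw [← ENNReal.ofReal_add (by positivity) (by positivity)]; congr 1; ring
    _ ≤ ENNReal.ofReal (∫ X, (a - b) ^ 2 / 2 * √(P X * Q X)) := by
        rw [integral_const_mul, hS]
        gcongr
    _ = ∫⁻ X, ENNReal.ofReal ((a - b) ^ 2 / 2 * √(P X * Q X)) :=
        ofReal_integral_eq_lintegral_ofReal (hSi.const_mul _)
          (.of_forall fun X => by positivity)
    _ ≤ ∫⁻ X, ((ENNReal.ofReal ((T X - a) ^ 2 * P X) + ENNReal.ofReal ((T X - b) ^ 2 * Q X))
          + ENNReal.ofReal ((a - b) ^ 2 / 16 * (P X + Q X))) := by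
        refine lintegral_mono fun X => ?_
        have h1 := mul_nonneg (sq_nonneg (T X - a)) (hP0 X)
        have h2 := mul_nonneg (sq_nonneg (T X - b)) (hQ0 X)
        have h3 := mul_nonneg (by positivity : 0 ≤ (a - b) ^ 2 / 16) (add_nonneg (hP0 X) (hQ0 X))
        dsimp only
        rw [← ENNReal.ofReal_add h1 h2, ← ENNReal.ofReal_add (add_nonneg h1 h2) h3]
        exact ENNReal.ofReal_le_ofReal (two_point_pointwise _ _ _ (hP0 X) (hQ0 X))
    _ = _ := by
        rw [lintegral_add_right' _ hPQ.1.aemeasurable.ennreal_ofReal]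
        congr 1
        rw [← ofReal_integral_eq_lintegral_ofReal hPQ
          (.of_forall fun X => mul_nonneg (by positivity) (add_nonneg (hP0 X) (hQ0 X))),
          integral_const_mul, integral_add hPi hQi, hP1, hQ1]
        congr 1
        ring

/-- Affinity of two bounded relative perturbations of the same density. -/
lemma affinity_lower_bound {f₀ u v : ℝ → ℝ} {β : ℝ} (h0 : ∀ x, 0 ≤ f₀ x) (hi : Integrable f₀)
    (h1 : ∫ x, f₀ x = 1) (hu : ∀ x, |u x| ≤ 1 / 2) (hv : ∀ x, |v x| ≤ 1 / 2)
    (huv : ∀ x, |u x - v x| ≤ 2 * β)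
    (hpi : Integrable fun x => f₀ x * (1 + u x)) (hqi : Integrable fun x => f₀ x * (1 + v x))
    (hp1 : ∫ x, f₀ x * (1 + u x) = 1) (hq1 : ∫ x, f₀ x * (1 + v x) = 1) :
    1 - 2 * β ^ 2 ≤ ∫ x, √(f₀ x * (1 + u x) * (f₀ x * (1 + v x))) := by
  have hub : ∀ x, 0 ≤ 1 + u x := fun x => by linarith [(abs_le.1 (hu x)).1]
  have hvb : ∀ x, 0 ≤ 1 + v x := fun x => by linarith [(abs_le.1 (hv x)).1]
  have hm : Integrable fun x => (1 / 2) * (f₀ x * (1 + u x)) + (1 / 2) * (f₀ x * (1 + v x)) :=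
    (hpi.const_mul _).add (hqi.const_mul _)
  calc 1 - 2 * β ^ 2
      = ∫ x, ((1 / 2) * (f₀ x * (1 + u x)) + (1 / 2) * (f₀ x * (1 + v x)) - 2 * β ^ 2 * f₀ x) := by
        rw [integral_sub hm (hi.const_mul _),
          integral_add (hpi.const_mul _) (hqi.const_mul _)]
        simp only [integral_const_mul, hp1, hq1, h1]
        ring
    _ ≤ _ := by
        refine integral_mono (hm.sub (hi.const_mul _))
          (integrable_sqrt_mul (fun x => mul_nonneg (h0 x) (hub x))
            (fun x => mul_nonneg (h0 x) (hvb x)) hpi hqi) fun x => ?_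
        obtain ⟨hu1, hu2⟩ := abs_le.1 (hu x)
        obtain ⟨hv1, hv2⟩ := abs_le.1 (hv x)
        have hd : (u x - v x) ^ 2 ≤ (2 * β) ^ 2 := sq_le_sq.2 ((huv x).trans (le_abs_self _))
        have e : f₀ x * (1 + u x) * (f₀ x * (1 + v x)) = f₀ x ^ 2 * ((1 + u x) * (1 + v x)) := by
          ring
        -- The geometric mean falls below the arithmetic mean by at most a quadratic term. The
        -- bounds `1/2` on `u` and `v` are just enough to make the last factor below nonnegative.
        have hs : 1 + (u x + v x) / 2 - (u x - v x) ^ 2 / 2 ≤ √((1 + u x) * (1 + v x)) := by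
          refine Real.le_sqrt_of_sq_le ?_
          have hd1 : (u x - v x) ^ 2 ≤ 1 := by
            rw [sq_le_one_iff_abs_le_one, abs_le]; constructor <;> linarith
          have : (1 + u x) * (1 + v x) - (1 + (u x + v x) / 2 - (u x - v x) ^ 2 / 2) ^ 2
              = (u x - v x) ^ 2 / 4 * (4 * (1 + (u x + v x) / 2) - 1 - (u x - v x) ^ 2) := by
            ring
          have h2 : 0 ≤ (u x - v x) ^ 2 / 4
              * (4 * (1 + (u x + v x) / 2) - 1 - (u x - v x) ^ 2) :=
            mul_nonneg (by positivity) (by linarith)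
          linarith
        dsimp only
        rw [e, Real.sqrt_mul (sq_nonneg _), Real.sqrt_sq (h0 x)]
        have := mul_le_mul_of_nonneg_left hs (h0 x)
        nlinarith [mul_nonneg (h0 x) (sub_nonneg.2 hd)]

end TwoPoint

/-! ### Averaging over the cube -/

section Cube

/-- Averaging over the vertices of the cube, as in Assouad's lemma. -/
lemma cube_average {m : ℕ} (E : Fin m → (Fin m → Bool) → ℝ≥0∞) {κ δ M : ℝ≥0∞}
    (h : ∀ j α, δ ≤ E j α + E j (Function.update α j (!α j)))
    (hM : ∀ α, κ * ∑ j, E j α ≤ M) : κ * (m * δ) ≤ 2 * M := by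
  -- Flipping one sign is an involution of the cube, so it only permutes the sum.
  have hflip : ∀ j, ∑ α, E j (Function.update α j (!α j)) = ∑ α, E j α := by
    intro j
    have hinv : Function.Involutive fun α : Fin m → Bool => Function.update α j (!α j) := by
      intro α; simp
    exact Equiv.sum_comp hinv.toPerm (E j)
  have hcard : (Fintype.card (Fin m → Bool) : ℝ≥0∞) ≠ 0 := by
    simp
  have h1 : (Fintype.card (Fin m → Bool) : ℝ≥0∞) * (m * δ) ≤ 2 * ∑ α, ∑ j, E j α := by
    calc (Fintype.card (Fin m → Bool) : ℝ≥0∞) * (m * δ)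
        = ∑ j : Fin m, ∑ _α : Fin m → Bool, δ := by
          simp only [Finset.sum_const, Finset.card_univ, nsmul_eq_mul, Fintype.card_fin]
          ring
      _ ≤ ∑ j, ∑ α, (E j α + E j (Function.update α j (!α j))) :=
          Finset.sum_le_sum fun j _ => Finset.sum_le_sum fun α _ => h j α
      _ = 2 * ∑ α, ∑ j, E j α := by
          simp only [Finset.sum_add_distrib, hflip]
          rw [Finset.sum_comm (f := fun j α => E j α), two_mul]
  refine (ENNReal.mul_le_mul_iff_right hcard (ENNReal.natCast_ne_top _)).1 ?_
  calc (Fintype.card (Fin m → Bool) : ℝ≥0∞) * (κ * (m * δ))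
      = κ * ((Fintype.card (Fin m → Bool) : ℝ≥0∞) * (m * δ)) := by ring
    _ ≤ κ * (2 * ∑ α, ∑ j, E j α) := by gcongr
    _ = 2 * ∑ α, κ * ∑ j, E j α := by rw [← Finset.mul_sum]; ring
    _ ≤ 2 * ∑ _α : Fin m → Bool, M := by gcongr with α; exact hM α
    _ = _ := by simp; ring

end Cube

/-! ### Mixtures with a sine-tilted normal mixing law -/

section Tilt

variable {m : ℕ}

/-- A mixture density is a probability density. -/
lemma integrable_normalMixture (Pi : Measure ℝ) [IsProbabilityMeasure Pi] :
    Integrable (normalMixture Pi) ∧ ∫ x, normalMixture Pi x = 1 := by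
  have hm : Measurable (normalMixture Pi) := by
    refine (StronglyMeasurable.integral_prod_right'
      (f := fun p : ℝ × ℝ => gaussianPDFReal 0 1 (p.1 - p.2)) ?_).measurable
    exact ((measurable_gaussianPDFReal 0 1).comp (by fun_prop)).stronglyMeasurable
  have h1 : ∫⁻ x, ENNReal.ofReal (normalMixture Pi x) = 1 := by
    have := measure_univ (μ := densityLaw (normalMixture Pi))
    rwa [densityLaw, withDensity_apply _ MeasurableSet.univ, Measure.restrict_univ] at this
  constructor
  · refine ⟨hm.aestronglyMeasurable, ?_⟩
    rw [hasFiniteIntegral_iff_ofReal (.of_forall (normalMixture_nonneg Pi)), h1]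
    exact ENNReal.one_lt_top
  · rw [integral_eq_lintegral_of_nonneg_ae (.of_forall (normalMixture_nonneg Pi))
      hm.aestronglyMeasurable, h1, ENNReal.toReal_one]

/-- The standard normal law tilted by a sine polynomial. -/
noncomputable def sineTilt (a : Fin m → ℝ) : Measure ℝ :=
  (gaussianReal 0 1).withDensity fun u =>
    ENNReal.ofReal (1 + ∑ j : Fin m, a j * Real.sin (((j : ℕ) + 1 : ℝ) * u))

lemma abs_sum_mul_sin_le (a : Fin m → ℝ) (y : Fin m → ℝ) :
    |∑ j, a j * Real.sin (y j)| ≤ ∑ j, |a j| := by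
  refine (Finset.abs_sum_le_sum_abs _ _).trans (Finset.sum_le_sum fun j _ => ?_)
  rw [abs_mul]
  exact mul_le_of_le_one_right (abs_nonneg _) (Real.abs_sin_le_one _)

/-- Serves twice: at mean `0` the sines vanish and the tilt has mass one; at mean `x / 2` and
variance `1 / 2` it evaluates the mixture. -/
lemma integral_one_add_sine (a : Fin m → ℝ) (μ : ℝ) (v : NNReal) :
    ∫ u, (1 + ∑ j : Fin m, a j * Real.sin (((j : ℕ) + 1 : ℝ) * u)) ∂(gaussianReal μ v)
      = 1 + ∑ j : Fin m, a j * (Real.exp (-(v * ((j : ℕ) + 1 : ℝ) ^ 2 / 2))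
          * Real.sin (((j : ℕ) + 1 : ℝ) * μ)) := by
  have hi : ∀ j : Fin m, Integrable (fun u => a j * Real.sin (((j : ℕ) + 1 : ℝ) * u))
      (gaussianReal μ v) := fun j =>
    (Integrable.of_bound (by fun_prop) 1 (.of_forall fun u => Real.abs_sin_le_one _)).const_mul _
  rw [integral_add (integrable_const _) (integrable_finsetSum _ fun j _ => hi j),
    integral_finsetSum _ fun j _ => hi j]
  simp [integral_const_mul, integral_sin_gaussianReal]

lemma isProbabilityMeasure_sineTilt {a : Fin m → ℝ} (ha : ∑ j, |a j| ≤ 1) :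
    IsProbabilityMeasure (sineTilt a) := by
  constructor
  rw [sineTilt, withDensity_apply _ MeasurableSet.univ, Measure.restrict_univ,
    ← ofReal_integral_eq_lintegral_ofReal, integral_one_add_sine]
  · simp
  · refine Integrable.of_bound (by fun_prop) 2 (.of_forall fun u => ?_)
    have := abs_le.1 ((abs_sum_mul_sin_le a fun j => ((j : ℕ) + 1 : ℝ) * u).trans ha)
    rw [Real.norm_eq_abs, abs_le]
    constructor <;> linarith [this.1, this.2]
  · refine .of_forall fun u => ?_
    have := abs_le.1 ((abs_sum_mul_sin_le a fun j => ((j : ℕ) + 1 : ℝ) * u).trans ha)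
    simp only [Pi.zero_apply]
    linarith [this.1]

lemma sineTilt_absolutelyContinuous (a : Fin m → ℝ) : sineTilt a ≪ volume :=
  (withDensity_absolutelyContinuous _ _).trans (gaussianReal_absolutelyContinuous 0 one_ne_zero)

/-- For independent standard normal `U` and `Z`, the sum `U + Z` is N(0,2), and given `U + Z = x`
the law of `U` is N(x/2, 1/2). -/
lemma gaussianPDFReal_mul_gaussianPDFReal (x u : ℝ) :
    gaussianPDFReal 0 1 u * gaussianPDFReal 0 1 (x - u)
      = gaussianPDFReal 0 2 x * gaussianPDFReal (x / 2) (1 / 2) u := by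
  simp only [gaussianPDFReal]
  rw [mul_mul_mul_comm, mul_mul_mul_comm _ _ (√_)⁻¹, ← Real.exp_add, ← Real.exp_add, ← mul_inv,
    ← mul_inv, ← Real.sqrt_mul (by positivity), ← Real.sqrt_mul (by positivity)]
  congr 2
  · congr 1
    push_cast
    ring
  · push_cast
    ring

lemma normalMixture_sineTilt {a : Fin m → ℝ} (ha : ∑ j, |a j| ≤ 1) (x : ℝ) :
    normalMixture (sineTilt a) x = gaussianPDFReal 0 2 x
      * (1 + ∑ j : Fin m, a j * Real.exp (-(((j : ℕ) + 1 : ℝ) ^ 2 / 4)) * halfSine j x) := by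
  rw [normalMixture, sineTilt, integral_withDensity_eq_integral_toReal_smul (by fun_prop)
    (.of_forall fun _ => ENNReal.ofReal_lt_top), integral_gaussianReal_eq_integral_smul one_ne_zero]
  have e : ∀ u : ℝ, gaussianPDFReal 0 1 u •
      (ENNReal.ofReal (1 + ∑ j : Fin m, a j * Real.sin (((j : ℕ) + 1 : ℝ) * u))).toReal •
        gaussianPDFReal 0 1 (x - u)
      = gaussianPDFReal 0 2 x * (gaussianPDFReal (x / 2) (1 / 2) u •
        (1 + ∑ j : Fin m, a j * Real.sin (((j : ℕ) + 1 : ℝ) * u))) := by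
    intro u
    have := abs_le.1 ((abs_sum_mul_sin_le a fun j => ((j : ℕ) + 1 : ℝ) * u).trans ha)
    rw [ENNReal.toReal_ofReal (by linarith [this.1])]
    simp only [smul_eq_mul]
    rw [← mul_assoc (gaussianPDFReal 0 2 x), ← gaussianPDFReal_mul_gaussianPDFReal]
    ring
  simp only [e]
  rw [integral_const_mul, ← integral_gaussianReal_eq_integral_smul (by norm_num),
    integral_one_add_sine]
  congr 2
  refine Finset.sum_congr rfl fun j _ => ?_
  rw [mul_assoc, halfSine]
  congr 3
  push_cast
  ring_nf

end Tilt

/-! ### The cube of perturbed densities and the lower bound -/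

section Family

variable {m : ℕ}

/-- The relative perturbation attached to a vertex of the cube. -/
noncomputable def cubeSine (β : ℝ) (α : Fin m → Bool) (x : ℝ) : ℝ :=
  ∑ j, β * (if α j then 1 else -1) * halfSine j x

/-- The perturbed density attached to a vertex of the cube. -/
noncomputable def cubeDensity (β : ℝ) (α : Fin m → Bool) (x : ℝ) : ℝ :=
  gaussianPDFReal 0 2 x * (1 + cubeSine β α x)

/-- The mixing coefficients carry `exp((j+1)²/4)` to cancel the damping exactly; the hypothesis on
their sum keeps the tilt nonnegative. -/
lemma cubeDensity_eq_normalMixture {β : ℝ} (hβ : 0 ≤ β)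
    (h : ∑ j : Fin m, β * Real.exp (((j : ℕ) + 1 : ℝ) ^ 2 / 4) ≤ 1) (α : Fin m → Bool) :
    ∃ Pi : Measure ℝ, IsProbabilityMeasure Pi ∧ Pi ≪ volume ∧
      cubeDensity β α = normalMixture Pi := by
  set a : Fin m → ℝ := fun j =>
    β * (if α j then 1 else -1) * Real.exp (((j : ℕ) + 1 : ℝ) ^ 2 / 4) with ha
  have habs : ∑ j, |a j| ≤ 1 := by
    refine le_trans (Finset.sum_le_sum fun j _ => ?_) h
    rw [ha, abs_mul, Real.abs_exp, abs_mul, abs_of_nonneg hβ]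
    split_ifs <;> simp
  refine ⟨sineTilt a, isProbabilityMeasure_sineTilt habs, sineTilt_absolutelyContinuous a, ?_⟩
  ext x
  rw [normalMixture_sineTilt habs, cubeDensity, cubeSine]
  congr 2
  refine Finset.sum_congr rfl fun j _ => ?_
  simp only [ha]
  rw [Real.exp_neg]
  field_simp

lemma abs_cubeSine_le {β : ℝ} (hβ : 0 ≤ β) (α : Fin m → Bool) (x : ℝ) :
    |cubeSine β α x| ≤ m * β := by
  refine (Finset.abs_sum_le_sum_abs _ _).trans ((Finset.sum_le_sum (g := fun _ => β)
    fun j _ => ?_).trans (by simp))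
  rw [abs_mul, abs_mul, abs_of_nonneg hβ]
  have := abs_halfSine_le j x
  split_ifs <;> simpa using mul_le_of_le_one_right hβ this

lemma abs_cubeSine_sub_flip_le {β : ℝ} (hβ : 0 ≤ β) (α : Fin m → Bool) (j : Fin m) (x : ℝ) :
    |cubeSine β α x - cubeSine β (Function.update α j (!α j)) x| ≤ 2 * β := by
  rw [cubeSine, cubeSine, ← Finset.sum_sub_distrib, Finset.sum_eq_single j]
  · have h := mul_le_of_le_one_right hβ (abs_halfSine_le j x)
    have h' := abs_le.1 ((abs_mul β _).trans_le
      ((abs_of_nonneg hβ).symm ▸ h : |β| * |halfSine j x| ≤ β))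
    rw [abs_le]
    cases hα : α j <;> simp <;> constructor <;> linarith [h'.1, h'.2]
  · intro k _ hk
    simp [hk]
  · simp

/-- The normalised coefficient of `g`, relative to the unperturbed density, on a sine. -/
noncomputable def sineCoeff (j : Fin m) (g : ℝ → ℝ) : ℝ :=
  (2 * Real.pi)⁻¹ * ∫ x, (g x / gaussianPDFReal 0 2 x - 1) * halfSine j x ∂window

lemma measurable_sineCoeff (j : Fin m) {n : ℕ} {fhat : (Fin n → ℝ) → ℝ → ℝ}
    (h : IsEstimator n fhat) : Measurable fun X => sineCoeff j (fhat X) := by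
  unfold IsEstimator at h
  have : StronglyMeasurable fun p : (Fin n → ℝ) × ℝ =>
      (fhat p.1 p.2 / gaussianPDFReal 0 2 p.2 - 1) * halfSine j p.2 :=
    (((h.div ((measurable_gaussianPDFReal 0 2).comp measurable_snd)).sub_const 1).mul
      ((measurable_halfSine j).comp measurable_snd)).stronglyMeasurable
  exact (this.integral_prod_right' (ν := window)).measurable.const_mul _

lemma gaussianPDFReal_window_le {x : ℝ} (hx : x ∈ Set.Ioc (-(2 * Real.pi)) (2 * Real.pi)) :
    gaussianPDFReal 0 2 (2 * Real.pi) ≤ gaussianPDFReal 0 2 x := by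
  unfold gaussianPDFReal
  gcongr 1
  refine Real.exp_le_exp.2 ?_
  have : x ^ 2 ≤ (2 * Real.pi) ^ 2 := sq_le_sq' hx.1.le hx.2
  simp only [sub_zero]
  gcongr

/-- Bessel's inequality turns the squared loss into a loss on the cube. -/
lemma sum_sineCoeff_le_sqLoss {g : ℝ → ℝ} (hg : Measurable g) (β : ℝ) (α : Fin m → Bool) :
    ENNReal.ofReal (gaussianPDFReal 0 2 (2 * Real.pi) ^ 2 * (2 * Real.pi))
        * ∑ j, ENNReal.ofReal ((sineCoeff j g - β * (if α j then 1 else -1)) ^ 2)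
      ≤ sqLoss g (cubeDensity β α) := by
  set f₀ := gaussianPDFReal 0 2 with hf₀
  have hf₀pos : ∀ x, 0 < f₀ x := fun x => gaussianPDFReal_pos 0 2 x two_ne_zero
  set r : ℝ → ℝ := fun x => g x / f₀ x - 1 - cubeSine β α x with hr
  have hcm : Measurable (cubeSine β α) := by
    unfold cubeSine
    exact Finset.measurable_fun_sum _ fun j _ => (measurable_halfSine j).const_mul _
  have hrm : Measurable r := ((hg.div (measurable_gaussianPDFReal 0 2)).sub_const 1).sub hcm
  have hloss : ENNReal.ofReal (f₀ (2 * Real.pi) ^ 2) * ∫⁻ x, ENNReal.ofReal (r x ^ 2) ∂window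
      ≤ sqLoss g (cubeDensity β α) := by
    rw [← lintegral_const_mul' _ _ ENNReal.ofReal_ne_top, window, sqLoss]
    refine le_trans (setLIntegral_mono' measurableSet_Ioc fun x hx => ?_)
      (setLIntegral_le_lintegral _ _)
    rw [← ENNReal.ofReal_mul (sq_nonneg _)]
    refine ENNReal.ofReal_le_ofReal ?_
    have e : g x - cubeDensity β α x = f₀ x * r x := by
      rw [hr, cubeDensity]
      have := (hf₀pos x).ne'
      field_simp
      ring
    rw [e, mul_pow]
    have h1 := gaussianPDFReal_window_le hx
    have h2 := (hf₀pos (2 * Real.pi)).le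
    gcongr
  refine le_trans ?_ hloss
  rw [ENNReal.ofReal_mul (sq_nonneg _), mul_assoc]
  gcongr
  -- Nothing forces the estimate to be square integrable on the window; where it is not, the loss is
  -- infinite.
  by_cases hL : MemLp r 2 window
  · have hcoeff : ∀ j : Fin m, (2 * Real.pi)⁻¹ * ∫ x, r x * halfSine j x ∂window
        = sineCoeff j g - β * (if α j then 1 else -1) := by
      intro j
      have hi : ∀ k : Fin m, Integrable (fun x => halfSine k x * halfSine j x) window :=
        fun k => (memLp_halfSine k window).integrable_mul (memLp_halfSine j window)
      have hri : Integrable (fun x => r x * halfSine j x) window :=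
        hL.integrable_mul (memLp_halfSine j window)
      have e : ∀ x, (g x / f₀ x - 1) * halfSine j x = r x * halfSine j x
          + ∑ k, β * (if α k then 1 else -1) * (halfSine k x * halfSine j x) := by
        intro x
        simp only [← mul_assoc, ← Finset.sum_mul]
        simp only [hr, cubeSine]
        ring
      rw [sineCoeff]
      simp only [← hf₀, e]
      rw [integral_add hri (integrable_finsetSum _ fun k _ => (hi k).const_mul _),
        integral_finsetSum _ fun k _ => (hi k).const_mul _]
      simp only [integral_const_mul, integral_halfSine_mul]
      simp only [mul_ite, mul_zero, Finset.sum_ite_eq', Finset.mem_univ, if_true]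
      field_simp
      ring
    have hb := bessel_of_orthogonal (fun j : Fin m => memLp_halfSine j window)
      (by positivity : 0 < 2 * Real.pi) integral_halfSine_mul hL
    simp only [hcoeff] at hb
    rw [← ENNReal.ofReal_sum_of_nonneg fun j _ => sq_nonneg _,
      ← ENNReal.ofReal_mul (by positivity),
      ← ofReal_integral_eq_lintegral_ofReal hL.integrable_sq (.of_forall fun _ => sq_nonneg _)]
    exact ENNReal.ofReal_le_ofReal hb
  · have : ∫⁻ x, ENNReal.ofReal (r x ^ 2) ∂window = ⊤ := by
      by_contra hne
      refine hL ((memLp_two_iff_integrable_sq hrm.aestronglyMeasurable).2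
        ⟨(hrm.pow_const 2).aestronglyMeasurable, ?_⟩)
      rw [hasFiniteIntegral_iff_ofReal (.of_forall fun x => sq_nonneg (r x))]
      exact lt_top_iff_ne_top.2 hne
    rw [this]
    exact le_top

/-- Assouad-type lower bound over the cube of perturbed densities. -/
lemma cube_risk_lower_bound {n : ℕ} {β : ℝ} (hβ : 0 ≤ β)
    (h : ∑ j : Fin m, β * Real.exp (((j : ℕ) + 1 : ℝ) ^ 2 / 4) ≤ 1 / 2)
    (hn : 4 * n * β ^ 2 ≤ 1) (hβ1 : β ≤ 1) {fhat : (Fin n → ℝ) → ℝ → ℝ} (hf : IsEstimator n fhat) :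
    ENNReal.ofReal (gaussianPDFReal 0 2 (2 * Real.pi) ^ 2 * (2 * Real.pi))
        * (m * ENNReal.ofReal (β ^ 2 / 2))
      ≤ 2 * ⨆ f ∈ mixtureClassAC, risk n fhat f := by
  have hmβ : m * β ≤ 1 / 2 := by
    refine le_trans ?_ h
    have : ∀ j ∈ (Finset.univ : Finset (Fin m)), β ≤ β * Real.exp (((j : ℕ) + 1 : ℝ) ^ 2 / 4) :=
      fun j _ => le_mul_of_one_le_right hβ (Real.one_le_exp (by positivity))
    simpa using Finset.sum_le_sum this
  have hmem : ∀ α : Fin m → Bool, cubeDensity β α ∈ mixtureClassAC := fun α => by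
    obtain ⟨Pi, h1, h2, h3⟩ := cubeDensity_eq_normalMixture hβ (h.trans (by norm_num)) α
    exact ⟨Pi, h1, h2, h3⟩
  have hprop : ∀ α : Fin m → Bool, (∀ x, 0 ≤ cubeDensity β α x) ∧ Integrable (cubeDensity β α) ∧
      ∫ x, cubeDensity β α x = 1 := fun α => by
    obtain ⟨Pi, h1, _, h3⟩ := cubeDensity_eq_normalMixture hβ (h.trans (by norm_num)) α
    rw [h3]
    exact ⟨normalMixture_nonneg Pi, integrable_normalMixture Pi⟩
  refine cube_average (fun j α => ∫⁻ X, ENNReal.ofReal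
    ((sineCoeff j (fhat X) - β * (if α j then 1 else -1)) ^ 2) ∂(sampleLaw n (cubeDensity β α)))
    (fun j α => ?_) (fun α => ?_)
  · set α' := Function.update α j (!α j) with hα'
    obtain ⟨hp0, hpi, hp1⟩ := hprop α
    obtain ⟨hq0, hqi, hq1⟩ := hprop α'
    have hA : 1 / 2 ≤ (∫ x, √(cubeDensity β α x * cubeDensity β α' x)) ^ n := by
      have h1 : 1 - 2 * β ^ 2 ≤ ∫ x, √(cubeDensity β α x * cubeDensity β α' x) :=
        affinity_lower_bound (gaussianPDFReal_nonneg 0 2) (integrable_gaussianPDFReal 0 2)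
          (integral_gaussianPDFReal_eq_one 0 two_ne_zero)
          (fun x => (abs_cubeSine_le hβ α x).trans hmβ)
          (fun x => (abs_cubeSine_le hβ α' x).trans hmβ)
          (abs_cubeSine_sub_flip_le hβ α j) hpi hqi hp1 hq1
      have hβ2 : β ^ 2 ≤ 1 := pow_le_one₀ hβ hβ1
      -- Bernoulli's inequality gives at least `1 - 2 n β² ≥ 1/2`; its side condition `-2 ≤ a` is
      -- where `β ≤ 1` enters.
      have h2 := one_add_mul_le_pow (a := (∫ x, √(cubeDensity β α x * cubeDensity β α' x)) - 1)
        (by linarith) n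
      rw [add_sub_cancel] at h2
      refine le_trans ?_ h2
      have h3 : (n : ℝ) * (-(2 * β ^ 2))
          ≤ n * ((∫ x, √(cubeDensity β α x * cubeDensity β α' x)) - 1) := by
        gcongr
        linarith
      linarith
    refine le_trans (ENNReal.ofReal_le_ofReal (le_of_eq ?_))
      (two_point_bound hp0 hq0 hpi hqi hp1 hq1 hA (measurable_sineCoeff j hf)
        (β * (if α j then 1 else -1)) (β * (if α' j then 1 else -1)))
    rw [hα']
    cases hαj : α j <;> simp <;> ring
  · refine le_trans ?_ (le_iSup₂ (f := fun f (_ : f ∈ mixtureClassAC) => risk n fhat f) _ (hmem α))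
    have hm : ∀ j : Fin m, Measurable fun X : Fin n → ℝ => ENNReal.ofReal
        ((sineCoeff j (fhat X) - β * (if α j then 1 else -1)) ^ 2) := fun j =>
      (((measurable_sineCoeff j hf).sub_const _).pow_const 2).ennreal_ofReal
    rw [← lintegral_finsetSum _ fun j _ => hm j,
      ← lintegral_const_mul' _ _ ENNReal.ofReal_ne_top, risk]
    refine lintegral_mono fun X => sum_sineCoeff_le_sqLoss ?_ β α
    unfold IsEstimator at hf
    exact hf.of_uncurry_left

/-- The sizes for which the cube of perturbations is admissible. -/
lemma sum_exp_sq_le {n : ℕ} (hn : 2 ≤ n) :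
    ∑ j : Fin ⌈√(Real.log n) / 2⌉₊,
      1 / (6 * √n) * Real.exp (((j : ℕ) + 1 : ℝ) ^ 2 / 4) ≤ 1 / 2 := by
  have hn1 : (2 : ℝ) ≤ n := by exact_mod_cast hn
  set s := √(Real.log n) with hs
  have hs0 : 0 ≤ s := Real.sqrt_nonneg _
  have hs2 : s ^ 2 = Real.log n := Real.sq_sqrt (Real.log_nonneg (by linarith))
  have hn0 : 0 < √(n : ℝ) := Real.sqrt_pos.2 (by linarith)
  set m := ⌈s / 2⌉₊ with hm
  have hm1 : (m : ℝ) ≤ s / 2 + 1 := (Nat.ceil_lt_add_one (by positivity)).le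
  have hterm : ∀ j ∈ (Finset.univ : Finset (Fin m)),
      1 / (6 * √n) * Real.exp (((j : ℕ) + 1 : ℝ) ^ 2 / 4)
        ≤ 1 / (6 * √n) * Real.exp ((m : ℝ) ^ 2 / 4) := fun j _ => by
    have : ((j : ℕ) + 1 : ℝ) ≤ m := by exact_mod_cast j.2
    gcongr
  -- The factor `m` is absorbed by a second exponential. Then `m ≤ s / 2 + 1` gives `m² / 2 ≤ 1 + s²
  -- / 2`, and `e < 3` accounts for the `6` in the amplitude.
  have h1 : (m : ℝ) * Real.exp ((m : ℝ) ^ 2 / 4) ≤ 3 * √n := by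
    calc (m : ℝ) * Real.exp ((m : ℝ) ^ 2 / 4)
        ≤ Real.exp ((m : ℝ) ^ 2 / 4) * Real.exp ((m : ℝ) ^ 2 / 4) := by
          gcongr
          nlinarith [Real.add_one_le_exp ((m : ℝ) ^ 2 / 4), sq_nonneg ((m : ℝ) - 2)]
      _ = Real.exp ((m : ℝ) ^ 2 / 2) := by rw [← Real.exp_add]; ring_nf
      _ ≤ Real.exp (1 + Real.log n / 2) := by
          refine Real.exp_le_exp.2 ?_
          have : (m : ℝ) ^ 2 ≤ (s / 2 + 1) ^ 2 := by gcongr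
          nlinarith [sq_nonneg (s / 2 - 1), sq_nonneg s]
      _ = Real.exp 1 * √n := by
          rw [Real.exp_add, Real.exp_half, Real.exp_log (by linarith)]
      _ ≤ 3 * √n := by
          gcongr
          linarith [Real.exp_one_lt_d9]
  calc _ ≤ ∑ _j : Fin m, 1 / (6 * √n) * Real.exp ((m : ℝ) ^ 2 / 4) := Finset.sum_le_sum hterm
    _ = 1 / (6 * √n) * (m * Real.exp ((m : ℝ) ^ 2 / 4)) := by simp; ring
    _ ≤ 1 / (6 * √n) * (3 * √n) := by gcongr
    _ = 1 / 2 := by field_simp; norm_num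

lemma exists_risk_lower_bound :
    ∃ c : ℝ, 0 < c ∧ ∀ n : ℕ, 2 ≤ n → ∀ fhat : (Fin n → ℝ) → ℝ → ℝ, IsEstimator n fhat →
      ENNReal.ofReal (c * rate n) ≤ ⨆ f ∈ mixtureClassAC, risk n fhat f := by
  set κ := gaussianPDFReal 0 2 (2 * Real.pi) ^ 2 * (2 * Real.pi) with hκ
  have hκ0 : 0 < κ := by
    have := gaussianPDFReal_pos 0 2 (2 * Real.pi) two_ne_zero
    positivity
  -- `288 = 2 * 2 * 72`: the factor `2` of the cube bound, `m ≥ √(log n) / 2`, and `β² / 2 = 1 / (72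
  -- n)`.
  refine ⟨κ / 288, by positivity, fun n hn fhat hf => ?_⟩
  have hn1 : (2 : ℝ) ≤ n := by exact_mod_cast hn
  have hsq : √(n : ℝ) ^ 2 = n := Real.sq_sqrt (by linarith)
  have hn0 : 1 ≤ √(n : ℝ) := Real.one_le_sqrt.2 (by linarith)
  have hb2 : (1 / (6 * √(n : ℝ))) ^ 2 = 1 / (36 * n) := by
    rw [div_pow, mul_pow, hsq]; norm_num
  have hb := cube_risk_lower_bound (β := 1 / (6 * √n)) (by positivity) (sum_exp_sq_le hn)
    (by rw [hb2]; field_simp; norm_num) (by rw [div_le_one (by positivity)]; linarith) hf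
  rw [← hκ, hb2] at hb
  refine (ENNReal.mul_le_mul_iff_right two_ne_zero ENNReal.ofNat_ne_top).1 (le_trans ?_ hb)
  rw [← ENNReal.ofReal_natCast, ← ENNReal.ofReal_mul (by positivity),
    ← ENNReal.ofReal_mul (by positivity), ← ENNReal.ofReal_ofNat 2,
    ← ENNReal.ofReal_mul (by positivity), rate_eq hn]
  refine ENNReal.ofReal_le_ofReal ?_
  calc 2 * (κ / 288 * (√(Real.log n) / n))
      = κ * (√(Real.log n) / 2 * (1 / (36 * n) / 2)) := by ring
    _ ≤ _ := by
        gcongr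
        exact Nat.le_ceil _

end Family

theorem theorem1p1 :
    (∃ c : ℝ, 0 < c ∧ ∀ n : ℕ, 2 ≤ n →
      ∀ fhat : (Fin n → ℝ) → ℝ → ℝ, IsEstimator n fhat →
        ENNReal.ofReal (c * rate n) ≤ (⨆ f ∈ mixtureClass, risk n fhat f) ∧
        ENNReal.ofReal (c * rate n) ≤ (⨆ f ∈ mixtureClassAC, risk n fhat f)) ∧
    (∃ C : ℝ, 0 < C ∧ ∀ n : ℕ, 2 ≤ n →
      ∃ fhat : (Fin n → ℝ) → ℝ → ℝ, IsEstimator n fhat ∧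
        (⨆ f ∈ mixtureClass, risk n fhat f) ≤ ENNReal.ofReal (C * rate n)) := by
  refine ⟨?_, exists_estimator_risk_le⟩
  obtain ⟨c, hc, h⟩ := exists_risk_lower_bound
  refine ⟨c, hc, fun n hn fhat hf => ⟨(h n hn fhat hf).trans ?_, h n hn fhat hf⟩⟩
  exact biSup_mono fun f ⟨Pi, h1, _, h3⟩ => ⟨Pi, h1, h3⟩
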